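/- For a real Banach space $X$ let $\mathcal K(X,X)$ be the space of compact linear operators on $X$. For a linear subspace $\mathcal U$ of the space $\mathcal L(X,X)$ of bounded linear operators on $X$, let $\operatorname{unc}(\mathcal U)$ denote the set (again a linear subspace) of all $T\in\mathcal L(X,X)$ for which there is a sequence $(T_n)$ in $\mathcal U$ such that for every $x\in X$ the series $\sum_n T_n x$ converges unconditionally to $Tx$. **Theorem.** There exists a real Banach space $X$ for which $$\mathrm{Id}\in \operatorname{unc}(\operatorname{unc}(\mathcal K(X,X)))\setminus \operatorname{unc}(\mathcal K(X,X)).$$ More precisely, whenever $(p_n)$ is a sequence with $1<p_n<\infty$ and $p_n\to1$, the $\ell_2$-sum $X=L_{p_1}[0,1]\oplus_2 L_{p_2}[0,1]\oplus_2\cdots$ of the real Lebesgue spaces $L_{p_n}[0,1]$ is a Banach space with this property. -/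

import Mathlib

open MeasureTheory Filter Topology
open scoped ENNReal

/-- For a linear subspace `U` of the space of bounded linear operators from `E` to `F`, `unc U` is
the set of all bounded operators `T` for which there is a sequence `(Tₙ)` in `U` such that, for
every `x`, the series `∑ Tₙ x` converges unconditionally to `T x` (`HasSum` is convergence
of the net of all finite partial sums). It is again a linear subspace. -/
def unc {E F : Type*} [NormedAddCommGroup E] [NormedSpace ℝ E]
    [NormedAddCommGroup F] [NormedSpace ℝ F]
    (U : Submodule ℝ (E →L[ℝ] F)) : Submodule ℝ (E →L[ℝ] F) where
  carrier := {T | ∃ S : ℕ → (E →L[ℝ] F), (∀ n, S n ∈ U) ∧ ∀ x, HasSum (fun n => S n x) (T x)}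
  zero_mem' := ⟨fun _ => 0, fun _ => U.zero_mem, fun x => by simp [hasSum_zero]⟩
  add_mem' := by
    rintro T T' ⟨S, hS, h⟩ ⟨S', hS', h'⟩
    exact ⟨fun n => S n + S' n, fun n => U.add_mem (hS n) (hS' n), fun x => (h x).add (h' x)⟩
  smul_mem' := by
    rintro c T ⟨S, hS, h⟩
    exact ⟨fun n => c • S n, fun n => U.smul_mem c (hS n), fun x => (h x).const_smul c⟩

/-- The space `𝒦(E, F)` of compact operators from `E` to `F`. -/
abbrev compactOps (E F : Type*) [NormedAddCommGroup E] [NormedSpace ℝ E]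
    [NormedAddCommGroup F] [NormedSpace ℝ F] : Submodule ℝ (E →L[ℝ] F) :=
  compactOperator (RingHom.id ℝ) E F

/-- The real space `L_p[0,1]` with respect to Lebesgue measure. -/
abbrev LpUnit (p : ℝ≥0∞) : Type :=
  Lp ℝ p (volume.restrict (Set.Icc (0 : ℝ) 1))

/-- The `ℓ₂`-sum of the spaces `L_{p₀}[0,1], L_{p₁}[0,1], …`. -/
abbrev L2SumLp (p : ℕ → ℝ≥0∞) [∀ n, Fact (1 ≤ p n)] : Type :=
  lp (fun n => LpUnit (p n)) 2

/-! Membership: the coordinate projections of an `ℓ₂`-sum add up unconditionally to the identity.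
Each factors through some `L_p` with `1 < p < ∞`, where the differences of the finite-rank dyadic
conditional expectations expand the identity unconditionally. This is `exists_dyadicExp_bound`, a
consequence of Burkholder's inequality `exists_martingale_transform_bound`.

Non-membership: the unconditionality constant of any expansion of the identity of `L_p` into compact
operators blows up as `p → 1`. If `Id = ∑ T k` on the whole space, uniform boundedness gives one
constant `C` for all finite partial sums, and compression to a coordinate keeps `C`. In `L_p` let
`x` be a product of `2s` factors `1 + r`, with `r` running through Rademacher functions of rapidly
increasing index. These are weakly null, so finitely many compact `T k` nearly annihilate the next
one. Hence a suitable partial sum of `∑ T k` selects every other martingale difference of `x`, up to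
a small error. The selected sum `y` has `L_1`-norm at least `s / 2`, while `‖x‖` is at most `2 ^ ((p
- 1) * 2s)`. So `s / 2 ≤ C * 2 ^ ((p - 1) * 2s) + 1` (`le_of_compact_expansion`), which fails for a
large fixed `s` once `p` is close to `1`. -/

/-! ### Burkholder's inequality by means of a directionally concave function. -/

theorem sum_range_two_pow_succ (n : ℕ) (g : ℕ → ℝ) :
    ∑ j ∈ Finset.range (2 ^ (n + 1)), g j =
      ∑ i ∈ Finset.range (2 ^ n), (g (2 * i) + g (2 * i + 1)) := by
  rw [pow_succ, mul_comm]
  generalize 2 ^ n = m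
  induction m with
  | zero => simp
  | succ m ih =>
    rw [show 2 * (m + 1) = 2 * m + 1 + 1 by ring, Finset.sum_range_succ, Finset.sum_range_succ, ih,
      Finset.sum_range_succ]
    ring

/-- The `p`-th power of the Euclidean norm of `(√l x, y)`. -/
noncomputable def ellPow (p l x y : ℝ) : ℝ := (l * x ^ 2 + y ^ 2) ^ (p / 2)

/-- The second derivative of `ellPow` in direction `(1, a)`. -/
noncomputable def ellPowDeriv2 (p l a x y : ℝ) : ℝ :=
  p * (l * x ^ 2 + y ^ 2) ^ (p / 2 - 2) *
    ((l + a ^ 2) * (l * x ^ 2 + y ^ 2) + (p - 2) * (l * x + a * y) ^ 2)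

theorem continuous_ellPow {p : ℝ} (hp : 1 < p) (l : ℝ) :
    Continuous fun z : ℝ × ℝ => ellPow p l z.1 z.2 := by
  unfold ellPow
  refine Continuous.rpow_const (by fun_prop) fun _ => Or.inr (by linarith)

theorem hasDerivAt_ellPow_base (l a x y t : ℝ) :
    HasDerivAt (fun t => l * (x + t) ^ 2 + (y + a * t) ^ 2)
      (2 * (l * (x + t) + a * (y + a * t))) t := by
  have e1 : HasDerivAt (fun t => x + t) 1 t := (hasDerivAt_id t).const_add x
  have e2 : HasDerivAt (fun t => y + a * t) (a * 1) t :=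
    ((hasDerivAt_id t).const_mul a).const_add y
  refine (((e1.fun_pow 2).const_mul l).fun_add (e2.fun_pow 2)).congr_deriv ?_
  push_cast
  ring

theorem hasDerivAt_ellPow (p l a x y t : ℝ) (ht : 0 < l * (x + t) ^ 2 + (y + a * t) ^ 2) :
    HasDerivAt (fun t => ellPow p l (x + t) (y + a * t))
      (p * (l * (x + t) + a * (y + a * t)) *
        (l * (x + t) ^ 2 + (y + a * t) ^ 2) ^ (p / 2 - 1)) t := by
  refine ((hasDerivAt_ellPow_base l a x y t).rpow_const (p := p / 2) (Or.inl ht.ne')).congr_deriv ?_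
  ring

theorem hasDerivAt_deriv_ellPow (p l a x y t : ℝ)
    (ht : 0 < l * (x + t) ^ 2 + (y + a * t) ^ 2) :
    HasDerivAt (fun t => p * (l * (x + t) + a * (y + a * t)) *
        (l * (x + t) ^ 2 + (y + a * t) ^ 2) ^ (p / 2 - 1))
      (ellPowDeriv2 p l a (x + t) (y + a * t)) t := by
  have e1 : HasDerivAt (fun t => x + t) 1 t := (hasDerivAt_id t).const_add x
  have e2 : HasDerivAt (fun t => y + a * t) (a * 1) t :=
    ((hasDerivAt_id t).const_mul a).const_add y
  have h2 := ((e1.const_mul l).fun_add (e2.const_mul a)).const_mul p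
  refine (h2.fun_mul ((hasDerivAt_ellPow_base l a x y t).rpow_const (p := p / 2 - 1)
    (Or.inl ht.ne'))).congr_deriv ?_
  have hr : (l * (x + t) ^ 2 + (y + a * t) ^ 2) ^ (p / 2 - 1) =
      (l * (x + t) ^ 2 + (y + a * t) ^ 2) ^ (p / 2 - 2) *
        (l * (x + t) ^ 2 + (y + a * t) ^ 2) := by
    rw [← Real.rpow_add_one ht.ne']
    congr 1; ring
  rw [ellPowDeriv2, show p / 2 - 1 - 1 = p / 2 - 2 by ring, hr]
  ring

theorem ellPow_cauchy (l a x y : ℝ) (hl : 0 ≤ l) :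
    (l * x + a * y) ^ 2 ≤ (l + a ^ 2) * (l * x ^ 2 + y ^ 2) := by
  nlinarith [mul_nonneg hl (sq_nonneg (a * x - y))]

/-- The term with `p - 2` is dropped for `p ≤ 2` and bounded by Cauchy–Schwarz for `p ≥ 2`; in the
next lemma the two cases exchange roles. -/
theorem ellPowDeriv2_le {p : ℝ} (hp : 1 < p) (a x y : ℝ) (ha : |a| ≤ 1)
    (h : 0 < x ^ 2 + y ^ 2) :
    ellPowDeriv2 p 1 a x y ≤ 2 * p ^ 2 * (x ^ 2 + y ^ 2) ^ (p / 2 - 1) := by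
  have hr : (x ^ 2 + y ^ 2) ^ (p / 2 - 1) = (x ^ 2 + y ^ 2) ^ (p / 2 - 2) * (x ^ 2 + y ^ 2) := by
    rw [← Real.rpow_add_one h.ne']
    congr 1; ring
  have hc := ellPow_cauchy 1 a x y zero_le_one
  have hs := sq_nonneg (1 * x + a * y)
  have ha2 : a ^ 2 ≤ 1 := by nlinarith [abs_nonneg a, sq_abs a]
  have key : (1 + a ^ 2) * (1 * x ^ 2 + y ^ 2) + (p - 2) * (1 * x + a * y) ^ 2 ≤
      2 * p * (x ^ 2 + y ^ 2) := by
    rcases le_total p 2 with h2 | h2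
    · nlinarith
    · have h3 : (1 + a ^ 2) * (1 * x ^ 2 + y ^ 2) ≤ 2 * (x ^ 2 + y ^ 2) := by nlinarith
      have := mul_le_mul_of_nonneg_left (hc.trans h3) (sub_nonneg.2 h2)
      nlinarith
  have hpos := Real.rpow_pos_of_pos h (p / 2 - 2)
  unfold ellPowDeriv2
  rw [hr]
  have := mul_le_mul_of_nonneg_left key (by positivity : 0 ≤ p * (x ^ 2 + y ^ 2) ^ (p / 2 - 2))
  simp only [one_mul] at this ⊢
  linarith

theorem le_ellPowDeriv2 {p : ℝ} (hp : 1 < p) (l a x y : ℝ) (hl : 1 ≤ l)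
    (h : 0 < l * x ^ 2 + y ^ 2) :
    p * min 1 (p - 1) * l * (l * x ^ 2 + y ^ 2) ^ (p / 2 - 1) ≤ ellPowDeriv2 p l a x y := by
  have hr : (l * x ^ 2 + y ^ 2) ^ (p / 2 - 1) =
      (l * x ^ 2 + y ^ 2) ^ (p / 2 - 2) * (l * x ^ 2 + y ^ 2) := by
    rw [← Real.rpow_add_one h.ne']
    congr 1; ring
  have hc := ellPow_cauchy l a x y (by linarith)
  have hs := sq_nonneg (l * x + a * y)
  have hm0 : 0 < min 1 (p - 1) := lt_min one_pos (by linarith)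
  have hla : l * (l * x ^ 2 + y ^ 2) ≤ (l + a ^ 2) * (l * x ^ 2 + y ^ 2) := by
    nlinarith [sq_nonneg a]
  have key : min 1 (p - 1) * l * (l * x ^ 2 + y ^ 2) ≤
      (l + a ^ 2) * (l * x ^ 2 + y ^ 2) + (p - 2) * (l * x + a * y) ^ 2 := by
    rcases le_total p 2 with h2 | h2
    · rw [min_eq_right (by linarith)]
      nlinarith
    · rw [min_eq_left (by linarith)]
      nlinarith
  have hpos := Real.rpow_pos_of_pos h (p / 2 - 2)
  unfold ellPowDeriv2
  rw [hr]
  have := mul_le_mul_of_nonneg_left key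
    (by positivity : 0 ≤ p * (l * x ^ 2 + y ^ 2) ^ (p / 2 - 2))
  linarith

/-- The left factor tends to infinity with `l`, so for large `l` the second derivative of `ellPow p
l` dominates any multiple of the bound for `ellPow p 1`. The sign of `p / 2 - 1` decides which term
of the minimum is used. -/
theorem min_mul_rpow_le {p : ℝ} (l x y : ℝ) (hl : 1 ≤ l) (h : 0 < x ^ 2 + y ^ 2) :
    min l (l ^ (p / 2)) * (x ^ 2 + y ^ 2) ^ (p / 2 - 1) ≤
      l * (l * x ^ 2 + y ^ 2) ^ (p / 2 - 1) := by
  have hl0 : 0 < l := by linarith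
  have h1 : x ^ 2 + y ^ 2 ≤ l * x ^ 2 + y ^ 2 := by nlinarith [sq_nonneg x]
  have h2 : l * x ^ 2 + y ^ 2 ≤ l * (x ^ 2 + y ^ 2) := by nlinarith [sq_nonneg y]
  have hpos := Real.rpow_pos_of_pos h (p / 2 - 1)
  rcases le_total 0 (p / 2 - 1) with hp | hp
  · have := Real.rpow_le_rpow h.le h1 hp
    calc _ ≤ l * (x ^ 2 + y ^ 2) ^ (p / 2 - 1) := by gcongr; exact min_le_left _ _
      _ ≤ _ := by gcongr
  · have := Real.rpow_le_rpow_of_nonpos (by linarith) h2 hp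
    rw [Real.mul_rpow hl0.le h.le] at this
    calc _ ≤ l ^ (p / 2) * (x ^ 2 + y ^ 2) ^ (p / 2 - 1) := by gcongr; exact min_le_right _ _
      _ = l * (l ^ (p / 2 - 1) * (x ^ 2 + y ^ 2) ^ (p / 2 - 1)) := by
        rw [← mul_assoc, mul_comm l, ← Real.rpow_add_one hl0.ne']; congr 2; ring
      _ ≤ _ := by gcongr

/-- If `l` is large, `M * ellPow p 1 - ellPow p l` is midpoint concave in all directions `(1, a)`
with `|a| ≤ 1`. -/
theorem ellPow_midpoint {p : ℝ} (hp : 1 < p) (M l : ℝ) (hM : 0 ≤ M) (hl : 1 ≤ l)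
    (hMl : M * (2 * p ^ 2) ≤ p * min 1 (p - 1) * min l (l ^ (p / 2)))
    (a x y d : ℝ) (ha : |a| ≤ 1) :
    (M * ellPow p 1 (x + d) (y + a * d) - ellPow p l (x + d) (y + a * d)) +
      (M * ellPow p 1 (x - d) (y - a * d) - ellPow p l (x - d) (y - a * d)) ≤
      2 * (M * ellPow p 1 x y - ellPow p l x y) := by
  -- For these `y` the line through `(x, y)` in direction `(1, a)` misses the origin, so both
  -- functions are smooth along it. The excluded value follows by density and continuity.
  have gen : ∀ y, y ≠ a * x →
      (M * ellPow p 1 (x + d) (y + a * d) - ellPow p l (x + d) (y + a * d)) +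
      (M * ellPow p 1 (x - d) (y - a * d) - ellPow p l (x - d) (y - a * d)) ≤
      2 * (M * ellPow p 1 x y - ellPow p l x y) := by
    intro y hy
    have pos1 : ∀ t, 0 < (x + t) ^ 2 + (y + a * t) ^ 2 := by
      intro t
      by_contra! hcon
      have h1 : x + t = 0 := by nlinarith [sq_nonneg (x + t), sq_nonneg (y + a * t)]
      have h2 : y + a * t = 0 := by nlinarith [sq_nonneg (x + t), sq_nonneg (y + a * t)]
      apply hy
      have : t = -x := by linarith
      subst this; linarith
    have posl : ∀ t, 0 < l * (x + t) ^ 2 + (y + a * t) ^ 2 := fun t => by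
      nlinarith [pos1 t, sq_nonneg (x + t)]
    have pos1' : ∀ t, 0 < 1 * (x + t) ^ 2 + (y + a * t) ^ 2 := fun t => by
      simpa using pos1 t
    have D1 : ∀ t, HasDerivAt
        (fun t => M * ellPow p 1 (x + t) (y + a * t) - ellPow p l (x + t) (y + a * t)) _ t :=
      fun t => ((hasDerivAt_ellPow p 1 a x y t (pos1' t)).const_mul M).sub
        (hasDerivAt_ellPow p l a x y t (posl t))
    have D2 := fun t => ((hasDerivAt_deriv_ellPow p 1 a x y t (pos1' t)).const_mul M).sub
        (hasDerivAt_deriv_ellPow p l a x y t (posl t))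
    have conc : ConcaveOn ℝ Set.univ
        (fun t => M * ellPow p 1 (x + t) (y + a * t) - ellPow p l (x + t) (y + a * t)) := by
      refine concaveOn_of_hasDerivWithinAt2_nonpos convex_univ
        (fun t _ => (D1 t).continuousAt.continuousWithinAt)
        (fun t _ => (D1 t).hasDerivWithinAt) (fun t _ => (D2 t).hasDerivWithinAt) ?_
      intro t _
      have b1 := ellPowDeriv2_le hp a (x + t) (y + a * t) ha (pos1 t)
      have b2 := le_ellPowDeriv2 hp l a (x + t) (y + a * t) hl (posl t)
      have b3 := min_mul_rpow_le (p := p) l (x + t) (y + a * t) hl (pos1 t)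
      have hm0 : 0 < min 1 (p - 1) := lt_min one_pos (by linarith)
      have b4 := mul_le_mul_of_nonneg_left b3 (by positivity : 0 ≤ p * min 1 (p - 1))
      have b5 := mul_le_mul_of_nonneg_right hMl (Real.rpow_nonneg (pos1 t).le (p / 2 - 1))
      have b6 := mul_le_mul_of_nonneg_left b1 hM
      simp only [sub_nonpos]
      linarith
    have := conc.2 (Set.mem_univ d) (Set.mem_univ (-d)) (by norm_num : (0:ℝ) ≤ 1 / 2)
      (by norm_num : (0:ℝ) ≤ 1 / 2) (by norm_num)
    simp only [smul_eq_mul] at this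
    rw [show (1:ℝ) / 2 * d + 1 / 2 * -d = 0 by ring] at this
    simp only [add_zero, mul_zero, mul_neg, ← sub_eq_add_neg] at this
    linarith
  have hcl : IsClosed {y : ℝ |
      (M * ellPow p 1 (x + d) (y + a * d) - ellPow p l (x + d) (y + a * d)) +
      (M * ellPow p 1 (x - d) (y - a * d) - ellPow p l (x - d) (y - a * d)) ≤
      2 * (M * ellPow p 1 x y - ellPow p l x y)} := by
    have c : ∀ l (f g : ℝ → ℝ), Continuous f → Continuous g →
        Continuous fun y => ellPow p l (f y) (g y) :=
      fun l f g hf hg => (continuous_ellPow hp l).comp (hf.prodMk hg)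
    refine isClosed_le ?_ ?_
    · refine (((c _ _ _ ?_ ?_).const_mul _).sub (c _ _ _ ?_ ?_)).add
        (((c _ _ _ ?_ ?_).const_mul _).sub (c _ _ _ ?_ ?_)) <;> fun_prop
    · refine Continuous.const_mul (((c _ _ _ ?_ ?_).const_mul _).sub (c _ _ _ ?_ ?_)) _ <;> fun_prop
  have hd : Dense {y : ℝ | y ≠ a * x} := dense_compl_singleton (a * x)
  have := hcl.closure_subset_iff.2 (fun y hy => gen y hy : {y : ℝ | y ≠ a * x} ⊆ _)
  rw [hd.closure_eq] at this
  exact this (Set.mem_univ y)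

/-- Burkholder's inequality for transforms of dyadic martingales, in discrete form: `a n i` is the
value of the martingale at time `n` on the `i`-th interval of length `2⁻ⁿ`. -/
theorem exists_martingale_transform_bound {p : ℝ} (hp : 1 < p) :
    ∃ C : ℝ, 0 ≤ C ∧ ∀ (N : ℕ) (a y : ℕ → ℕ → ℝ) (θ : ℕ → ℝ), (∀ n, |θ n| ≤ 1) →
      (∀ n i, a n i = (a (n + 1) (2 * i) + a (n + 1) (2 * i + 1)) / 2) →
      (∀ n j, y (n + 1) j = y n (j / 2) + θ n * (a (n + 1) j - a n (j / 2))) →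
      (∀ i, y 0 i = 0) →
      ∑ i ∈ Finset.range (2 ^ N), |y N i| ^ p ≤ C * ∑ i ∈ Finset.range (2 ^ N), |a N i| ^ p := by
  -- Subtracting `ellPow p l` costs at most `2 ^ (p / 2) * |y| ^ p` in the `y`-part; the extra `1`
  -- leaves `|y| ^ p` in the lower bound `hlow`.
  set M : ℝ := 2 ^ (p / 2) + 1 with hMdef
  have hp2 : 0 < p / 2 := by linarith
  have hM1 : 1 ≤ M := by
    have : (0:ℝ) < 2 ^ (p / 2) := by positivity
    linarith
  have hm0 : 0 < min 1 (p - 1) := lt_min one_pos (by linarith)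
  -- The second condition gives concavity, the third gives `U x 0 ≤ 0` at time `0`.
  obtain ⟨l, hl1, hl2, hl3⟩ : ∃ l : ℝ, 1 ≤ l ∧
      M * (2 * p ^ 2) ≤ p * min 1 (p - 1) * min l (l ^ (p / 2)) ∧ M ≤ l ^ (p / 2) := by
    have t1 : Tendsto (fun l : ℝ => l ^ (p / 2)) atTop atTop := tendsto_rpow_atTop hp2
    have t2 : Tendsto (fun l : ℝ => min l (l ^ (p / 2))) atTop atTop := by
      refine tendsto_atTop.2 fun b => ?_
      filter_upwards [eventually_ge_atTop b, t1.eventually_ge_atTop b] with l h1 h2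
      exact le_min h1 h2
    have t3 := t2.const_mul_atTop (by positivity : 0 < p * min 1 (p - 1))
    obtain ⟨l, h⟩ := ((eventually_ge_atTop 1).and ((t3.eventually_ge_atTop (M * (2 * p ^ 2))).and
      (t1.eventually_ge_atTop M))).exists
    exact ⟨l, h.1, h.2.1, h.2.2⟩
  have hl0 : 0 < l := by linarith
  refine ⟨2 ^ (p / 2) * l ^ (p / 2), by positivity, ?_⟩
  intro N a y θ hθ ha hy hy0
  set U : ℝ → ℝ → ℝ := fun x y => M * ellPow p 1 x y - ellPow p l x y with hU
  have hmono : ∀ n, ∑ j ∈ Finset.range (2 ^ (n + 1)), U (a (n + 1) j) (y (n + 1) j) ≤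
      2 * ∑ i ∈ Finset.range (2 ^ n), U (a n i) (y n i) := by
    intro n
    rw [sum_range_two_pow_succ, Finset.mul_sum]
    refine Finset.sum_le_sum fun i _ => ?_
    rw [hy, hy, show 2 * i / 2 = i by omega, show (2 * i + 1) / 2 = i by omega]
    have h := ellPow_midpoint hp M l (by linarith) hl1 hl2 (θ n) (a n i) (y n i)
      (a (n + 1) (2 * i) - a n i) (hθ n)
    have e1 : a n i + (a (n + 1) (2 * i) - a n i) = a (n + 1) (2 * i) := by ring
    have e2 : a n i - (a (n + 1) (2 * i) - a n i) = a (n + 1) (2 * i + 1) := by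
      rw [ha n i]; ring
    have e3 : y n i - θ n * (a (n + 1) (2 * i) - a n i) =
        y n i + θ n * (a (n + 1) (2 * i + 1) - a n i) := by
      rw [← e2]; ring
    rw [e1, e2, e3] at h
    exact h
  have hsq : ∀ x : ℝ, (x ^ 2) ^ (p / 2) = |x| ^ p := by
    intro x
    rw [← sq_abs, ← Real.rpow_natCast_mul (abs_nonneg x)]
    congr 1; push_cast; ring
  have hnonpos : ∀ n, ∑ i ∈ Finset.range (2 ^ n), U (a n i) (y n i) ≤ 0 := by
    intro n
    induction n with
    | zero =>
      simp only [pow_zero, Finset.range_one, Finset.sum_singleton, hy0, hU, ellPow]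
      simp only [ne_eq, OfNat.ofNat_ne_zero, not_false_eq_true, zero_pow, add_zero, one_mul]
      rw [Real.mul_rpow hl0.le (sq_nonneg _), ← sub_mul]
      exact mul_nonpos_of_nonpos_of_nonneg (by linarith) (Real.rpow_nonneg (sq_nonneg _) _)
    | succ n ih => linarith [hmono n]
  have hlow : ∀ x y, |y| ^ p - 2 ^ (p / 2) * l ^ (p / 2) * |x| ^ p ≤ U x y := by
    intro x y
    have h1 : |y| ^ p ≤ ellPow p 1 x y := by
      rw [← hsq, ellPow]
      exact Real.rpow_le_rpow (sq_nonneg _) (by nlinarith [sq_nonneg x]) hp2.le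
    have h2 : ellPow p l x y ≤ 2 ^ (p / 2) * (l ^ (p / 2) * |x| ^ p + |y| ^ p) := by
      rw [ellPow, ← hsq, ← hsq, ← Real.mul_rpow hl0.le (sq_nonneg _)]
      have hx : 0 ≤ l * x ^ 2 := by positivity
      have n1 := Real.rpow_nonneg hx (p / 2)
      have n2 := Real.rpow_nonneg (sq_nonneg y) (p / 2)
      rcases le_total (l * x ^ 2) (y ^ 2) with h | h
      · calc (l * x ^ 2 + y ^ 2) ^ (p / 2) ≤ (2 * y ^ 2) ^ (p / 2) :=
              Real.rpow_le_rpow (by positivity) (by linarith) hp2.le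
          _ = 2 ^ (p / 2) * (y ^ 2) ^ (p / 2) := Real.mul_rpow (by norm_num) (sq_nonneg _)
          _ ≤ _ := by gcongr; linarith
      · calc (l * x ^ 2 + y ^ 2) ^ (p / 2) ≤ (2 * (l * x ^ 2)) ^ (p / 2) :=
              Real.rpow_le_rpow (by positivity) (by linarith) hp2.le
          _ = 2 ^ (p / 2) * (l * x ^ 2) ^ (p / 2) := Real.mul_rpow (by norm_num) hx
          _ ≤ _ := by gcongr; linarith
    have h3 := mul_le_mul_of_nonneg_left h1 (by linarith : 0 ≤ M)
    simp only [hU]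
    rw [hMdef] at h3 ⊢
    nlinarith
  have := (Finset.sum_le_sum fun i (_ : i ∈ Finset.range (2 ^ N)) => hlow (a N i) (y N i)).trans
    (hnonpos N)
  rw [Finset.sum_sub_distrib, ← Finset.mul_sum] at this
  linarith

/-! ### Dyadic step functions on the unit interval. -/

/-- Lebesgue measure on `[0,1]`. -/
noncomputable abbrev unitMeasure : Measure ℝ := volume.restrict (Set.Icc (0 : ℝ) 1)

instance isProbabilityMeasure_unitMeasure : IsProbabilityMeasure unitMeasure :=
  ⟨by simp [unitMeasure]⟩

/-- The endpoint `1` lies in none of the first `2 ^ n` half-open dyadic intervals and has to be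
discarded as a null set. -/
theorem ae_unitMeasure_mem_Ico : ∀ᵐ x ∂unitMeasure, x ∈ Set.Ico (0 : ℝ) 1 := by
  have : unitMeasure = volume.restrict (Set.Ico (0 : ℝ) 1) :=
    Measure.restrict_congr_set Ico_ae_eq_Icc.symm
  rw [this]
  exact ae_restrict_mem measurableSet_Ico

/-- The dyadic interval `[i / 2ⁿ, (i + 1) / 2ⁿ)`. -/
def dyadicIco (n i : ℕ) : Set ℝ := Set.Ico ((i : ℝ) / 2 ^ n) ((i + 1) / 2 ^ n)

theorem measurableSet_dyadicIco (n i : ℕ) : MeasurableSet (dyadicIco n i) := measurableSet_Ico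

/-- The function with value `c i` on the dyadic interval `[i / 2ⁿ, (i + 1) / 2ⁿ)`. -/
noncomputable def stepFun (n : ℕ) (c : ℕ → ℝ) (x : ℝ) : ℝ := c ⌊2 ^ n * x⌋₊

theorem mem_dyadicIco {n i : ℕ} {x : ℝ} (hx : 0 ≤ x) : x ∈ dyadicIco n i ↔ ⌊2 ^ n * x⌋₊ = i := by
  have h2 : (0:ℝ) < 2 ^ n := by positivity
  rw [Nat.floor_eq_iff (by positivity), dyadicIco, Set.mem_Ico, div_le_iff₀' h2, lt_div_iff₀' h2]

theorem dyadicIco_nonneg {n i : ℕ} {x : ℝ} (hx : x ∈ dyadicIco n i) : 0 ≤ x :=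
  le_trans (by positivity) hx.1

theorem stepFun_of_mem {n i : ℕ} {x : ℝ} (c : ℕ → ℝ) (hx : x ∈ dyadicIco n i) :
    stepFun n c x = c i := by
  rw [stepFun, (mem_dyadicIco (dyadicIco_nonneg hx)).1 hx]

theorem floor_lt_two_pow {n : ℕ} {x : ℝ} (hx : x ∈ Set.Ico (0 : ℝ) 1) : ⌊2 ^ n * x⌋₊ < 2 ^ n := by
  have h2 : (0:ℝ) < 2 ^ n := by positivity
  rw [Nat.floor_lt (mul_nonneg h2.le hx.1)]
  push_cast
  nlinarith [hx.2]

theorem dyadicIco_subset {n i : ℕ} (hi : i < 2 ^ n) : dyadicIco n i ⊆ Set.Icc 0 1 := by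
  intro x hx
  refine ⟨dyadicIco_nonneg hx, hx.2.le.trans ?_⟩
  rw [div_le_one (by positivity)]
  exact_mod_cast hi

theorem dyadicIco_eq_union (n i : ℕ) :
    dyadicIco n i = dyadicIco (n + 1) (2 * i) ∪ dyadicIco (n + 1) (2 * i + 1) := by
  have h2 : (0:ℝ) < 2 ^ n := by positivity
  unfold dyadicIco
  have e1 : (((2 * i : ℕ) : ℝ)) / 2 ^ (n + 1) = i / 2 ^ n := by
    rw [pow_succ]; push_cast; field_simp
  have e2 : (((2 * i + 1 : ℕ) : ℝ) + 1) / 2 ^ (n + 1) = (i + 1) / 2 ^ n := by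
    rw [pow_succ]; push_cast; field_simp; ring
  have e3 : (((2 * i + 1 : ℕ) : ℝ)) / 2 ^ (n + 1) = (((2 * i : ℕ) : ℝ) + 1) / 2 ^ (n + 1) := by
    push_cast; rfl
  rw [e1, e2, e3, Set.Ico_union_Ico_eq_Ico]
  · rw [← e1]; gcongr; linarith
  · rw [← e2, ← e3]; gcongr; linarith

theorem disjoint_dyadicIco {n i j : ℕ} (h : i ≠ j) : Disjoint (dyadicIco n i) (dyadicIco n j) := by
  rw [Set.disjoint_left]
  intro x hx hy
  have h0 := dyadicIco_nonneg hx
  exact h (((mem_dyadicIco h0).1 hx).symm.trans ((mem_dyadicIco h0).1 hy))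

theorem measureReal_dyadicIco {n i : ℕ} (hi : i < 2 ^ n) :
    unitMeasure.real (dyadicIco n i) = (2 ^ n)⁻¹ := by
  rw [measureReal_restrict_apply (measurableSet_dyadicIco n i),
    Set.inter_eq_left.2 (dyadicIco_subset hi), dyadicIco, Real.volume_real_Ico_of_le]
  · field_simp; ring
  · gcongr; linarith

theorem measurable_stepFun (n : ℕ) (c : ℕ → ℝ) : Measurable (stepFun n c) :=
  (measurable_of_countable c).comp (Nat.measurable_floor.comp (measurable_const_mul _))

theorem stepFun_comp_half (n : ℕ) (c : ℕ → ℝ) (x : ℝ) :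
    stepFun (n + 1) (fun j => c (j / 2)) x = stepFun n c x := by
  change c (⌊2 ^ (n + 1) * x⌋₊ / 2) = c ⌊2 ^ n * x⌋₊
  rw [← Nat.floor_div_natCast (2 ^ (n + 1) * x) 2]
  congr 2
  push_cast
  ring

theorem stepFun_bounded (n : ℕ) (c : ℕ → ℝ) :
    ∃ C, ∀ᵐ x ∂unitMeasure, ‖stepFun n c x‖ ≤ C := by
  refine ⟨∑ i ∈ Finset.range (2 ^ n), |c i|, ?_⟩
  filter_upwards [ae_unitMeasure_mem_Ico] with x hx
  exact Finset.single_le_sum (f := fun i => |c i|) (fun i _ => abs_nonneg _)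
    (Finset.mem_range.2 (floor_lt_two_pow hx))

theorem memLp_stepFun (p : ℝ≥0∞) (n : ℕ) (c : ℕ → ℝ) : MemLp (stepFun n c) p unitMeasure :=
  let ⟨C, hC⟩ := stepFun_bounded n c
  MemLp.of_bound (measurable_stepFun n c).aestronglyMeasurable C hC

theorem integral_stepFun (n : ℕ) (c : ℕ → ℝ) :
    ∫ x, stepFun n c x ∂unitMeasure = (∑ i ∈ Finset.range (2 ^ n), c i) / 2 ^ n := by
  have h : stepFun n c =ᵐ[unitMeasure]
      fun x => ∑ i ∈ Finset.range (2 ^ n), (dyadicIco n i).indicator (fun _ => c i) x := by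
    filter_upwards [ae_unitMeasure_mem_Ico] with x hx
    rw [Finset.sum_eq_single_of_mem ⌊2 ^ n * x⌋₊ (Finset.mem_range.2 (floor_lt_two_pow hx))]
    · rw [Set.indicator_of_mem ((mem_dyadicIco hx.1).2 rfl), stepFun]
    · intro j _ hj
      exact Set.indicator_of_notMem (fun hm => hj ((mem_dyadicIco hx.1).1 hm).symm) _
  rw [integral_congr_ae h, integral_finsetSum]
  · rw [Finset.sum_div]
    refine Finset.sum_congr rfl fun i hi => ?_
    rw [integral_indicator_const _ (measurableSet_dyadicIco n i),
      measureReal_dyadicIco (Finset.mem_range.1 hi), smul_eq_mul]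
    ring
  · intro i _
    exact (integrable_const _).indicator (measurableSet_dyadicIco n i)

theorem setIntegral_stepFun (n : ℕ) (c : ℕ → ℝ) {i : ℕ} (hi : i < 2 ^ n) :
    ∫ x in dyadicIco n i, stepFun n c x ∂unitMeasure = c i / 2 ^ n := by
  rw [setIntegral_congr_fun (g := fun _ => c i) (measurableSet_dyadicIco n i)
    fun x hx => stepFun_of_mem c hx]
  rw [setIntegral_const, measureReal_dyadicIco hi, smul_eq_mul]
  ring

/-! ### Step functions and dyadic conditional expectations in `L_p`. -/

section Lp
variable (p : ℝ≥0∞)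

/-- The dyadic step function of level `n` with values `c i`, as an element of `L_p[0,1]`. -/
noncomputable def stepLp (n : ℕ) : (ℕ → ℝ) →ₗ[ℝ] LpUnit p where
  toFun c := (memLp_stepFun p n c).toLp
  map_add' _ _ := rfl
  map_smul' _ _ := rfl

theorem coeFn_stepLp (n : ℕ) (c : ℕ → ℝ) : stepLp p n c =ᵐ[unitMeasure] stepFun n c :=
  MemLp.coeFn_toLp (memLp_stepFun p n c)

theorem norm_stepLp (n : ℕ) (c : ℕ → ℝ) :
    ‖stepLp p n c‖ = (eLpNorm (stepFun n c) p unitMeasure).toReal :=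
  Lp.norm_toLp _ (memLp_stepFun p n c)

theorem stepLp_congr {n : ℕ} {c d : ℕ → ℝ} (h : ∀ i < 2 ^ n, c i = d i) :
    stepLp p n c = stepLp p n d := by
  refine Lp.ext ?_
  filter_upwards [coeFn_stepLp p n c, coeFn_stepLp p n d, ae_unitMeasure_mem_Ico] with x h1 h2 hx
  rw [h1, h2]
  exact h _ (floor_lt_two_pow hx)

theorem stepLp_comp_half (n : ℕ) (c : ℕ → ℝ) :
    stepLp p (n + 1) (fun j => c (j / 2)) = stepLp p n c := by
  refine Lp.ext ?_
  filter_upwards [coeFn_stepLp p (n + 1) (fun j => c (j / 2)), coeFn_stepLp p n c] with x h1 h2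
  rw [h1, h2, stepFun_comp_half]

variable {p} in
theorem norm_stepLp_rpow (h0 : p ≠ 0) (ht : p ≠ ⊤) (n : ℕ) (c : ℕ → ℝ) :
    ‖stepLp p n c‖ ^ p.toReal = (∑ i ∈ Finset.range (2 ^ n), |c i| ^ p.toReal) / 2 ^ n := by
  have hp : 0 < p.toReal := ENNReal.toReal_pos h0 ht
  rw [← integral_stepFun, norm_stepLp, toReal_eLpNorm (memLp_stepFun p n c).aestronglyMeasurable,
    lpNorm_eq_integral_norm_rpow_toReal h0 ht (memLp_stepFun p n c).aestronglyMeasurable,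
    ← Real.rpow_mul (integral_nonneg fun x => by positivity), inv_mul_cancel₀ hp.ne', Real.rpow_one]
  rfl

variable {p} in
theorem norm_stepLp_mono {q : ℝ≥0∞} (h : p ≤ q) (n : ℕ) (c : ℕ → ℝ) :
    ‖stepLp p n c‖ ≤ ‖stepLp q n c‖ := by
  rw [norm_stepLp, norm_stepLp]
  exact ENNReal.toReal_mono (memLp_stepFun q n c).eLpNorm_ne_top
    (eLpNorm_le_eLpNorm_of_exponent_le h (memLp_stepFun p n c).aestronglyMeasurable)

theorem norm_stepLp_one (n : ℕ) (c : ℕ → ℝ) :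
    ‖stepLp 1 n c‖ = (∑ i ∈ Finset.range (2 ^ n), |c i|) / 2 ^ n := by
  have := norm_stepLp_rpow one_ne_zero ENNReal.one_ne_top n c
  simpa using this

theorem norm_stepLp_two_sq (n : ℕ) (c : ℕ → ℝ) :
    ‖stepLp 2 n c‖ ^ 2 = (∑ i ∈ Finset.range (2 ^ n), c i ^ 2) / 2 ^ n := by
  have := norm_stepLp_rpow two_ne_zero ENNReal.ofNat_ne_top n c
  simpa using this

theorem norm_le_of_ae_bound_lpUnit {f : LpUnit p} {C : ℝ} (hC : 0 ≤ C)
    (h : ∀ᵐ x ∂unitMeasure, ‖f x‖ ≤ C) : ‖f‖ ≤ C := by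
  have := Lp.norm_le_of_ae_bound hC h
  simpa [measureUnivNNReal] using this

variable [Fact (1 ≤ p)]

theorem integrable_lpUnit (f : LpUnit p) : Integrable f unitMeasure :=
  (Lp.memLp f).integrable Fact.out

theorem integral_norm_le_norm (f : LpUnit p) : ∫ x, ‖f x‖ ∂unitMeasure ≤ ‖f‖ := by
  rw [← lpNorm_one_eq_integral_norm (Lp.aestronglyMeasurable f),
    ← toReal_eLpNorm (Lp.aestronglyMeasurable f), Lp.norm_def]
  exact ENNReal.toReal_mono (Lp.eLpNorm_ne_top f)
    (eLpNorm_le_eLpNorm_of_exponent_le Fact.out (Lp.aestronglyMeasurable f))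

/-- The mean of `f` on a dyadic interval. -/
noncomputable def dyadicMean (n i : ℕ) : LpUnit p →L[ℝ] ℝ :=
  LinearMap.mkContinuous
    { toFun f := 2 ^ n * ∫ x in dyadicIco n i, f x ∂unitMeasure
      map_add' f g := by
        rw [← mul_add, ← integral_add (integrable_lpUnit p f).integrableOn
          (integrable_lpUnit p g).integrableOn]
        congr 1
        exact integral_congr_ae (ae_restrict_of_ae (Lp.coeFn_add f g))
      map_smul' r f := by
        rw [RingHom.id_apply, smul_eq_mul, mul_left_comm, ← integral_const_mul r]
        congr 1
        exact integral_congr_ae (ae_restrict_of_ae (Lp.coeFn_smul r f)) }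
    (2 ^ n) (by
      intro f
      rw [LinearMap.coe_mk, AddHom.coe_mk, norm_mul, norm_pow, Real.norm_ofNat]
      gcongr
      exact ((norm_integral_le_integral_norm _).trans
        (setIntegral_le_integral (integrable_lpUnit p f).norm
          (ae_of_all _ fun x => norm_nonneg _))).trans (integral_norm_le_norm p f))

theorem dyadicMean_apply (n i : ℕ) (f : LpUnit p) :
    dyadicMean p n i f = 2 ^ n * ∫ x in dyadicIco n i, f x ∂unitMeasure := rfl

theorem dyadicMean_eq (n i : ℕ) (f : LpUnit p) :
    dyadicMean p n i f =
      (dyadicMean p (n + 1) (2 * i) f + dyadicMean p (n + 1) (2 * i + 1) f) / 2 := by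
  simp only [dyadicMean_apply]
  rw [dyadicIco_eq_union, setIntegral_union (disjoint_dyadicIco (by omega))
    (measurableSet_dyadicIco _ _) (integrable_lpUnit p f).integrableOn
    (integrable_lpUnit p f).integrableOn]
  ring

theorem dyadicMean_stepLp {n i : ℕ} (hi : i < 2 ^ n) (c : ℕ → ℝ) :
    dyadicMean p n i (stepLp p n c) = c i := by
  rw [dyadicMean_apply, integral_congr_ae (ae_restrict_of_ae (coeFn_stepLp p n c)),
    setIntegral_stepFun n c hi]
  field_simp

/-- The conditional expectation with respect to the dyadic intervals of length `2⁻ⁿ`. -/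
noncomputable def dyadicExp (n : ℕ) : LpUnit p →L[ℝ] LpUnit p :=
  ∑ i ∈ Finset.range (2 ^ n), (dyadicMean p n i).smulRight (stepLp p n (Pi.single i 1))

theorem dyadicExp_apply (n : ℕ) (f : LpUnit p) :
    dyadicExp p n f = stepLp p n (fun i => dyadicMean p n i f) := by
  simp only [dyadicExp, sum_apply, ContinuousLinearMap.smulRight_apply,
    ← map_smul, ← map_sum]
  refine stepLp_congr p fun j hj => ?_
  simp [Finset.sum_apply, Pi.single_apply, hj]

theorem dyadicExp_mem_compactOps (n : ℕ) :
    dyadicExp p n ∈ compactOps (LpUnit p) (LpUnit p) := by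
  refine Submodule.sum_mem _ fun i _ => ?_
  exact (isCompactOperator_of_locallyCompactSpace_dom (dyadicMean p n i)).clm_comp
    (ContinuousLinearMap.toSpanSingleton ℝ (stepLp p n (Pi.single i (1 : ℝ))))

theorem dyadicExp_stepLp {m n : ℕ} (h : m ≤ n) (c : ℕ → ℝ) :
    dyadicExp p n (stepLp p m c) = stepLp p m c := by
  obtain ⟨d, hd⟩ : ∃ d, stepLp p m c = stepLp p n d := by
    induction n, h using Nat.le_induction with
    | base => exact ⟨c, rfl⟩
    | succ n _ ih =>
      obtain ⟨d, hd⟩ := ih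
      exact ⟨_, hd.trans (stepLp_comp_half p n d).symm⟩
  rw [hd, dyadicExp_apply]
  exact stepLp_congr p fun i hi => dyadicMean_stepLp p hi d

/-- Continuous functions are dense, and uniform continuity makes the step function of left-endpoint
values uniformly close to a given one. -/
theorem dense_stepLp (hp : p ≠ ⊤) : Dense {f : LpUnit p | ∃ n c, f = stepLp p n c} := by
  have hd := BoundedContinuousFunction.toLp_denseRange ℝ unitMeasure (p := p) ℝ hp
  refine dense_closure.1 (hd.mono ?_)
  rintro _ ⟨g, rfl⟩
  rw [Metric.mem_closure_iff]
  intro ε hε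
  have hu := isCompact_Icc.uniformContinuousOn_of_continuous
    (g.continuous.continuousOn (s := Set.Icc (0:ℝ) 1))
  obtain ⟨δ, hδ, hg⟩ := Metric.uniformContinuousOn_iff.1 hu (ε / 2) (half_pos hε)
  obtain ⟨n, hn⟩ := exists_pow_lt_of_lt_one hδ (by norm_num : (1 / 2 : ℝ) < 1)
  refine ⟨stepLp p n (fun i => g (i / 2 ^ n)), ⟨n, _, rfl⟩, ?_⟩
  rw [dist_eq_norm]
  refine lt_of_le_of_lt (norm_le_of_ae_bound_lpUnit p (half_pos hε).le ?_) (half_lt_self hε)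
  filter_upwards [Lp.coeFn_sub (BoundedContinuousFunction.toLp p unitMeasure ℝ g)
    (stepLp p n (fun i => g (i / 2 ^ n))), coeFn_stepLp p n (fun i => g (i / 2 ^ n)),
    BoundedContinuousFunction.coeFn_toLp (p := p) (μ := unitMeasure) ℝ g,
    ae_unitMeasure_mem_Ico] with x h1 h2 h3 hx
  rw [h1, Pi.sub_apply, h2, h3, stepFun, ← dist_eq_norm]
  have h2n : (0:ℝ) < 2 ^ n := by positivity
  have l1 := Nat.floor_le (mul_nonneg h2n.le hx.1)
  have l2 := Nat.lt_floor_add_one (2 ^ n * x)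
  have l3 : (⌊2 ^ n * x⌋₊ : ℝ) / 2 ^ n ≤ x := by rwa [div_le_iff₀' h2n]
  refine (hg x ⟨hx.1, hx.2.le⟩ _ ⟨by positivity, l3.trans hx.2.le⟩ ?_).le
  rw [Real.dist_eq, abs_of_nonneg (sub_nonneg.2 l3)]
  refine lt_of_lt_of_le ?_ hn.le
  rw [one_div, inv_pow, sub_lt_iff_lt_add, ← one_div, ← add_div, lt_div_iff₀ h2n]
  linarith

end Lp

/-! ### The identity as an iterated unconditional sum of compact operators. -/

/-- On `D` the telescoping series is a finite sum; the uniform bound on finite partial sums carries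
convergence over to the closure. -/
theorem id_mem_unc_of_dense {E : Type*} [NormedAddCommGroup E] [NormedSpace ℝ E]
    (U : Submodule ℝ (E →L[ℝ] E)) (A : ℕ → E →L[ℝ] E) (hA : ∀ n, A n ∈ U) {D : Set E}
    (hD : Dense D) (hAD : ∀ x ∈ D, ∃ N, ∀ n ≥ N, A n x = x) (C : ℝ)
    (hC : ∀ x ∈ D, ∀ F : Finset ℕ, ‖∑ n ∈ F, (A (n + 1) x - A n x)‖ ≤ C * ‖x‖) :
    ContinuousLinearMap.id ℝ E ∈ unc U := by
  have hC' : ∀ (F : Finset ℕ) (x : E), ‖∑ n ∈ F, (A (n + 1) x - A n x)‖ ≤ C * ‖x‖ := by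
    intro F x
    have hcl : IsClosed {x : E | ‖∑ n ∈ F, (A (n + 1) x - A n x)‖ ≤ C * ‖x‖} :=
      isClosed_le (by fun_prop) (by fun_prop)
    exact hcl.closure_subset_iff.2 (fun x hx => hC x hx F) (hD x)
  have hsD : ∀ x ∈ D, HasSum (fun n => A (n + 1) x - A n x) (x - A 0 x) := by
    intro x hx
    obtain ⟨N, hN⟩ := hAD x hx
    have := hasSum_sum_of_ne_finset_zero (f := fun n => A (n + 1) x - A n x)
      (s := Finset.range N) (L := SummationFilter.unconditional ℕ) (by
        intro n hn
        rw [Finset.mem_range, not_lt] at hn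
        rw [hN n hn, hN (n + 1) (by omega), sub_self])
    rwa [Finset.sum_range_sub (fun n => A n x), hN N le_rfl] at this
  have hs : ∀ x, HasSum (fun n => A (n + 1) x - A n x) (x - A 0 x) := by
    intro x
    rw [HasSum, Metric.tendsto_nhds]
    intro ε hε
    have hK : 0 < |C| + 1 + ‖A 0‖ := by positivity
    obtain ⟨y, hy, hxy⟩ := hD.exists_dist_lt x (div_pos (half_pos hε) hK)
    have h2 := hsD y hy
    rw [HasSum, Metric.tendsto_nhds] at h2
    filter_upwards [h2 (ε / 2) (half_pos hε)] with F hF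
    rw [dist_eq_norm] at hF hxy ⊢
    have e : ∑ n ∈ F, (A (n + 1) x - A n x) - (x - A 0 x) =
        ∑ n ∈ F, (A (n + 1) (x - y) - A n (x - y)) +
          (∑ n ∈ F, (A (n + 1) y - A n y) - (y - A 0 y)) - ((x - y) - A 0 (x - y)) := by
      simp only [map_sub, Finset.sum_sub_distrib]
      abel
    rw [lt_div_iff₀ hK] at hxy
    have h3 := hC' F (x - y)
    have h4 := (A 0).le_opNorm (x - y)
    have h5 := mul_le_mul_of_nonneg_right (le_abs_self C) (norm_nonneg (x - y))
    rw [e]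
    calc _ ≤ ‖∑ n ∈ F, (A (n + 1) (x - y) - A n (x - y))‖ +
          ‖∑ n ∈ F, (A (n + 1) y - A n y) - (y - A 0 y)‖ + (‖x - y‖ + ‖A 0 (x - y)‖) :=
          (norm_sub_le _ _).trans (add_le_add (norm_add_le _ _) (norm_sub_le _ _))
      _ < ε := by linarith
  refine ⟨fun n => n.casesOn (A 0) fun n => A (n + 1) - A n, ?_, ?_⟩
  · rintro (_ | n)
    · exact hA 0
    · exact U.sub_mem (hA _) (hA _)
  · intro x
    rw [← hasSum_nat_add_iff' 1]
    simpa using hs x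

/-- Unconditionality of the dyadic martingale differences in `L_p[0,1]`, on step functions. -/
theorem exists_dyadicExp_bound (p : ℝ≥0∞) [Fact (1 ≤ p)] (hp : 1 < p) (ht : p ≠ ⊤) :
    ∃ C : ℝ, ∀ (m : ℕ) (c : ℕ → ℝ) (F : Finset ℕ),
      ‖∑ n ∈ F, (dyadicExp p (n + 1) (stepLp p m c) - dyadicExp p n (stepLp p m c))‖ ≤
        C * ‖stepLp p m c‖ := by
  have h0 : p ≠ 0 := (zero_lt_one.trans hp).ne'
  have hp1 : 1 < p.toReal := by
    rw [← ENNReal.toReal_one]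
    exact (ENNReal.toReal_lt_toReal ENNReal.one_ne_top ht).2 hp
  obtain ⟨C, hC0, hC⟩ := exists_martingale_transform_bound hp1
  refine ⟨C ^ (p.toReal⁻¹), fun m c F => ?_⟩
  set f := stepLp p m c with hf
  obtain ⟨N, hN⟩ : ∃ N, F ⊆ Finset.range N := ⟨F.sup id + 1, fun n hn =>
    Finset.mem_range.2 (Nat.lt_succ_of_le (Finset.le_sup (f := id) hn))⟩
  set a : ℕ → ℕ → ℝ := fun n i => dyadicMean p n i f with ha
  -- The partial sum over `F` is the martingale transform with these multipliers.
  set θ : ℕ → ℝ := fun n => if n ∈ F then 1 else 0 with hθ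
  let y : ℕ → ℕ → ℝ := fun n => Nat.rec (fun _ => 0)
    (fun n z j => z (j / 2) + θ n * (a (n + 1) j - a n (j / 2))) n
  have hE : ∀ n, dyadicExp p n f = stepLp p n (a n) := fun n => dyadicExp_apply p n f
  have hy : ∀ n, stepLp p n (y n) =
      ∑ k ∈ Finset.range n, θ k • (dyadicExp p (k + 1) f - dyadicExp p k f) := by
    intro n
    induction n with
    | zero => exact map_zero (stepLp p 0)
    | succ n ih =>
      rw [Finset.sum_range_succ, ← ih, ← stepLp_comp_half p n (y n), hE, hE,
        ← stepLp_comp_half p n (a n), ← map_sub, ← map_smul, ← map_add]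
      rfl
  -- At level `max N m` all differences indexed by `F` have occurred and `f` is already measurable.
  have hsum : ∑ n ∈ F, (dyadicExp p (n + 1) f - dyadicExp p n f) =
      stepLp p (max N m) (y (max N m)) := by
    rw [hy]
    simp only [hθ, ite_smul, one_smul, zero_smul]
    rw [← Finset.sum_filter, Finset.filter_mem_eq_inter, Finset.inter_eq_right.2
      (hN.trans (Finset.range_mono (le_max_left _ _)))]
  have hfN : f = stepLp p (max N m) (a (max N m)) := by
    rw [← hE, hf, dyadicExp_stepLp p (le_max_right _ _)]
  have key := hC (max N m) a y θ (by intro n; simp only [hθ]; split_ifs <;> simp)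
    (fun n i => dyadicMean_eq p n i f) (fun n j => rfl) (fun i => rfl)
  have key2 : ‖stepLp p (max N m) (y (max N m))‖ ^ p.toReal ≤
      C * ‖stepLp p (max N m) (a (max N m))‖ ^ p.toReal := by
    rw [norm_stepLp_rpow h0 ht, norm_stepLp_rpow h0 ht, ← mul_div_assoc]
    gcongr
  rw [hsum]
  conv_rhs => rw [hfN]
  have hpp : 0 < p.toReal := by linarith
  rw [← Real.rpow_le_rpow_iff (norm_nonneg _) (by positivity) hpp,
    Real.mul_rpow (by positivity) (norm_nonneg _), ← Real.rpow_mul hC0,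
    inv_mul_cancel₀ hpp.ne', Real.rpow_one]
  exact key2

theorem id_mem_unc_compactOps_lpUnit (p : ℝ≥0∞) [Fact (1 ≤ p)] (hp : 1 < p) (ht : p ≠ ⊤) :
    ContinuousLinearMap.id ℝ (LpUnit p) ∈ unc (compactOps (LpUnit p) (LpUnit p)) := by
  obtain ⟨C, hC⟩ := exists_dyadicExp_bound p hp ht
  refine id_mem_unc_of_dense _ (dyadicExp p) (dyadicExp_mem_compactOps p) (dense_stepLp p ht) ?_ C ?_
  · rintro _ ⟨m, c, rfl⟩
    exact ⟨m, fun n hn => dyadicExp_stepLp p hn c⟩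
  · rintro _ ⟨m, c, rfl⟩ F
    exact hC m c F

theorem id_mem_unc_unc_compactOps (p : ℕ → ℝ≥0∞) [∀ n, Fact (1 ≤ p n)]
    (hp_gt : ∀ n, 1 < p n) (hp_lt : ∀ n, p n < ⊤) :
    ContinuousLinearMap.id ℝ (L2SumLp p) ∈ unc (unc (compactOps (L2SumLp p) (L2SumLp p))) := by
  let J := fun n => lp.singleContinuousLinearMap ℝ (fun n => LpUnit (p n)) 2 n
  let P := fun n => lp.evalCLM ℝ (fun n => LpUnit (p n)) 2 n
  refine ⟨fun n => (J n).comp (P n), fun n => ?_, fun x => ?_⟩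
  · obtain ⟨S, hS, hsum⟩ := id_mem_unc_compactOps_lpUnit (p n) (hp_gt n) (hp_lt n).ne
    refine ⟨fun k => (J n).comp ((S k).comp (P n)), fun k => ?_, fun x => ?_⟩
    · exact ((hS k).comp_clm (P n)).clm_comp (J n)
    · exact (hsum (P n x)).mapL (J n)
  · exact lp.hasSum_single ENNReal.ofNat_ne_top x

/-! ### Rademacher functions and compact operators. -/

/-- The mean of the dyadic step function of level `n` with values `c i`. -/
noncomputable def dyadicAvg (n : ℕ) (c : ℕ → ℝ) : ℝ := (∑ i ∈ Finset.range (2 ^ n), c i) / 2 ^ n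

theorem dyadicAvg_succ (n : ℕ) (c : ℕ → ℝ) :
    dyadicAvg (n + 1) c = dyadicAvg n fun i => (c (2 * i) + c (2 * i + 1)) / 2 := by
  rw [dyadicAvg, dyadicAvg, sum_range_two_pow_succ, ← Finset.sum_div, pow_succ]
  field_simp

theorem dyadicAvg_comp_div (n m : ℕ) (c : ℕ → ℝ) :
    dyadicAvg (n + m) (fun i => c (i / 2 ^ m)) = dyadicAvg n c := by
  induction m with
  | zero => simp
  | succ m ih =>
    rw [← ih, ← add_assoc, dyadicAvg_succ]
    congr 1
    ext i
    rw [pow_succ', ← Nat.div_div_eq_div_mul, ← Nat.div_div_eq_div_mul,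
      show 2 * i / 2 = i by omega, show (2 * i + 1) / 2 = i by omega]
    ring

theorem dyadicAvg_mono {n : ℕ} {c d : ℕ → ℝ} (h : ∀ i, c i ≤ d i) :
    dyadicAvg n c ≤ dyadicAvg n d := by
  unfold dyadicAvg
  gcongr
  exact h _

theorem dyadicAvg_add (n : ℕ) (c d : ℕ → ℝ) :
    dyadicAvg n (fun i => c i + d i) = dyadicAvg n c + dyadicAvg n d := by
  rw [dyadicAvg, dyadicAvg, dyadicAvg, Finset.sum_add_distrib, add_div]

theorem dyadicAvg_const_mul (n : ℕ) (r : ℝ) (c : ℕ → ℝ) :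
    dyadicAvg n (fun i => r * c i) = r * dyadicAvg n c := by
  rw [dyadicAvg, dyadicAvg, ← Finset.mul_sum, mul_div_assoc]

theorem stepLp_comp_div (p : ℝ≥0∞) (n m : ℕ) (c : ℕ → ℝ) :
    stepLp p (n + m) (fun i => c (i / 2 ^ m)) = stepLp p n c := by
  induction m with
  | zero => simp
  | succ m ih =>
    rw [← ih, ← stepLp_comp_half p (n + m), ← add_assoc]
    simp only [Nat.div_div_eq_div_mul, ← pow_succ']

/-- The values at level `n + m + 1` of the product of a step function of level `n` with
the `(n + m + 1)`-st Rademacher function. -/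
def mulRademacher (c : ℕ → ℝ) (m j : ℕ) : ℝ := c (j / 2 ^ (m + 1)) * (-1) ^ j

theorem mulRademacher_even (c : ℕ → ℝ) (m i : ℕ) :
    mulRademacher c m (2 * i) = c (i / 2 ^ m) := by
  rw [mulRademacher, pow_succ', ← Nat.div_div_eq_div_mul, show 2 * i / 2 = i by omega]
  simp

theorem mulRademacher_odd (c : ℕ → ℝ) (m i : ℕ) :
    mulRademacher c m (2 * i + 1) = -c (i / 2 ^ m) := by
  rw [mulRademacher, pow_succ', ← Nat.div_div_eq_div_mul, show (2 * i + 1) / 2 = i by omega]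
  simp [pow_succ]

/-- The product of a step function with a Rademacher function, as an element of `L_p[0,1]`. -/
noncomputable def rademacherLp (p : ℝ≥0∞) (n : ℕ) (c : ℕ → ℝ) (m : ℕ) : LpUnit p :=
  stepLp p (n + m + 1) (mulRademacher c m)

/-- For `p ≤ 2` the norm is at most the `L_2`-norm, where the summands are orthogonal. -/
theorem norm_sum_rademacherLp_le {p : ℝ≥0∞} [Fact (1 ≤ p)] (hp : p ≤ 2) (n : ℕ) (c b : ℕ → ℝ)
    (M : ℕ) :
    ‖∑ m ∈ Finset.range M, b m • rademacherLp p n c m‖ ^ 2 ≤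
      dyadicAvg n (fun i => c i ^ 2) * ∑ m ∈ Finset.range M, b m ^ 2 := by
  let w : ℕ → ℕ → ℝ := fun M => Nat.rec (fun _ => 0)
    (fun m z j => z (j / 2) + b m * mulRademacher c m j) M
  have hw : ∀ M, ∑ m ∈ Finset.range M, b m • rademacherLp p n c m = stepLp p (n + M) (w M) := by
    intro M
    induction M with
    | zero => exact (map_zero (stepLp p n)).symm
    | succ M ih =>
      rw [Finset.sum_range_succ, ih, ← stepLp_comp_half p (n + M) (w M), rademacherLp, ← map_smul,
        ← map_add]
      rfl
  have hsq : ∀ M, dyadicAvg (n + M) (fun i => w M i ^ 2) =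
      dyadicAvg n (fun i => c i ^ 2) * ∑ m ∈ Finset.range M, b m ^ 2 := by
    intro M
    induction M with
    | zero => simp [dyadicAvg, w]
    | succ M ih =>
      rw [Finset.sum_range_succ, mul_add, ← ih, ← add_assoc, dyadicAvg_succ,
        ← dyadicAvg_comp_div n M, mul_comm _ (b M ^ 2), ← dyadicAvg_const_mul, ← dyadicAvg_add]
      congr 1
      ext i
      have e1 : w (M + 1) (2 * i) = w M i + b M * c (i / 2 ^ M) := by
        change w M (2 * i / 2) + b M * mulRademacher c M (2 * i) = _
        rw [mulRademacher_even, show 2 * i / 2 = i by omega]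
      have e2 : w (M + 1) (2 * i + 1) = w M i - b M * c (i / 2 ^ M) := by
        change w M ((2 * i + 1) / 2) + b M * mulRademacher c M (2 * i + 1) = _
        rw [mulRademacher_odd, show (2 * i + 1) / 2 = i by omega]
        ring
      rw [e1, e2]
      ring
  rw [hw, ← hsq]
  calc _ ≤ ‖stepLp 2 (n + M) (w M)‖ ^ 2 := by
        gcongr
        exact norm_stepLp_mono hp _ _
    _ = _ := norm_stepLp_two_sq _ _

/-- Applying `φ` to the combination whose coefficients are its own values `b m` bounds `∑ b m ^ 2`
by `‖φ‖ ^ 2 * A`, so the values are square summable. -/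
theorem tendsto_functional_rademacherLp {p : ℝ≥0∞} [Fact (1 ≤ p)] (hp : p ≤ 2) (n : ℕ)
    (c : ℕ → ℝ) (φ : LpUnit p →L[ℝ] ℝ) :
    Tendsto (fun m => φ (rademacherLp p n c m)) atTop (𝓝 0) := by
  set b : ℕ → ℝ := fun m => φ (rademacherLp p n c m) with hb
  set A := dyadicAvg n (fun i => c i ^ 2) with hA
  have hA0 : 0 ≤ A := by unfold A dyadicAvg; positivity
  have hsum : Summable fun m => b m ^ 2 := by
    refine summable_of_sum_range_le (c := ‖φ‖ ^ 2 * A) (fun m => sq_nonneg _) fun M => ?_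
    set q := ∑ m ∈ Finset.range M, b m ^ 2 with hq
    have hq0 : 0 ≤ q := Finset.sum_nonneg fun _ _ => sq_nonneg _
    have h1 : q = φ (∑ m ∈ Finset.range M, b m • rademacherLp p n c m) := by
      rw [map_sum, hq]
      refine Finset.sum_congr rfl fun m _ => ?_
      rw [map_smul, smul_eq_mul, sq]
    have h2 := φ.le_opNorm (∑ m ∈ Finset.range M, b m • rademacherLp p n c m)
    rw [← h1, Real.norm_of_nonneg hq0] at h2
    have h3 := norm_sum_rademacherLp_le hp n c b M
    have h4 : q ^ 2 ≤ ‖φ‖ ^ 2 * (A * q) := by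
      calc q ^ 2 ≤ (‖φ‖ * ‖∑ m ∈ Finset.range M, b m • rademacherLp p n c m‖) ^ 2 := by gcongr
        _ ≤ _ := by rw [mul_pow]; gcongr
    rcases hq0.eq_or_lt with h | h
    · rw [← h]; positivity
    · nlinarith
  have h := hsum.tendsto_atTop_zero
  have h2 := h.sqrt
  simp only [Real.sqrt_sq_eq_abs, Real.sqrt_zero] at h2
  exact (tendsto_zero_iff_abs_tendsto_zero _).2 h2

/-- Compact operators map bounded weakly null sequences to norm null sequences. -/
theorem IsCompactOperator.tendsto_zero_of_weakly_null {E F : Type*} [NormedAddCommGroup E]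
    [NormedSpace ℝ E] [NormedAddCommGroup F] [NormedSpace ℝ F] {T : E →L[ℝ] F}
    (hT : IsCompactOperator T) {u : ℕ → E} {K : ℝ} (hu : ∀ m, ‖u m‖ ≤ K)
    (hw : ∀ φ : E →L[ℝ] ℝ, Tendsto (fun m => φ (u m)) atTop (𝓝 0)) :
    Tendsto (fun m => T (u m)) atTop (𝓝 0) := by
  have hc := hT.isCompact_closure_image_closedBall (𝕜₁ := ℝ) (f := (T : E →ₗ[ℝ] F)) K
  refine hc.tendsto_nhds_of_unique_mapClusterPt (Eventually.of_forall fun m =>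
    subset_closure ⟨u m, by simpa using hu m, rfl⟩) fun v _ hv => ?_
  refine (SeparatingDual.eq_zero_iff_forall_dual_eq_zero (R := ℝ) v).2 fun φ => ?_
  have h1 : MapClusterPt (φ v) atTop (φ ∘ fun m => T (u m)) :=
    hv.continuousAt_comp φ.continuous.continuousAt
  have h2 : Tendsto (φ ∘ fun m => T (u m)) atTop (𝓝 0) := hw (φ.comp T)
  exact eq_of_nhds_neBot (h1.clusterPt.mono h2)

theorem tendsto_compact_rademacherLp {p : ℝ≥0∞} [Fact (1 ≤ p)] (hp : p ≤ 2) (n : ℕ)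
    (c : ℕ → ℝ) {T : LpUnit p →L[ℝ] LpUnit p} (hT : IsCompactOperator T) :
    Tendsto (fun m => T (rademacherLp p n c m)) atTop (𝓝 0) := by
  refine hT.tendsto_zero_of_weakly_null (K := √(dyadicAvg n (fun i => c i ^ 2))) (fun m => ?_)
    (tendsto_functional_rademacherLp hp n c)
  refine Real.le_sqrt_of_sq_le ?_
  have := norm_sum_rademacherLp_le hp n c (Pi.single m 1) (m + 1)
  simpa [Pi.single_apply, Finset.sum_ite_eq'] using this

/-! ### Lower bound for compact expansions of the identity of `L_p`. -/

/-- Approximate data for a sum of Haar functions along one branch: a nonnegative density `x` of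
mean `1`, a partial sum `y` of its martingale differences and a partial sum of `∑ T k` that maps
`x` almost to `y`. -/
def HaarBranch (p : ℝ≥0∞) [Fact (1 ≤ p)] (T : ℕ → LpUnit p →L[ℝ] LpUnit p) (ρ A B ε : ℝ) : Prop :=
  ∃ (n : ℕ) (x y : ℕ → ℝ) (G S : Finset ℕ), G ⊆ S ∧ (∀ i, 0 ≤ x i) ∧ dyadicAvg n x = 1 ∧
    dyadicAvg n (fun i => |x i| ^ p.toReal) = B ∧ (∀ i, x i = 0 ∨ |y i| ≤ ρ * x i) ∧
    A ≤ dyadicAvg n (fun i => |y i|) ∧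
    ‖∑ k ∈ G, T k (stepLp p n x) - stepLp p n y‖ ≤ ε ∧
    ∀ t : Finset ℕ, Disjoint t S → ‖∑ k ∈ t, T k (stepLp p n x)‖ ≤ ε

section Branch
variable {p : ℝ≥0∞} [Fact (1 ≤ p)] {T : ℕ → LpUnit p →L[ℝ] LpUnit p}

theorem haarBranch_zero (hsum : ∀ f, HasSum (fun k => T k f) f) {ε : ℝ} (hε : 0 < ε) :
    HaarBranch p T (1 / 2) 0 1 ε := by
  obtain ⟨S, hS⟩ := summable_iff_vanishing_norm.1 (hsum (stepLp p 0 fun _ => 1)).summable ε hε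
  refine ⟨0, fun _ => 1, fun _ => 0, ∅, S, Finset.empty_subset _, fun _ => zero_le_one, ?_, ?_, ?_,
    ?_, ?_, fun t ht => (hS t ht).le⟩
  · simp [dyadicAvg]
  · simp [dyadicAvg]
  · intro i; right; norm_num
  · simp [dyadicAvg]
  · have : stepLp p 0 (fun _ => 0) = 0 := map_zero (stepLp p 0)
    simpa [this] using hε.le

/-- Multiply `x` by `1 + r` with `r` a late Rademacher function, and add `θ * x * r` to `y`. The new
density is `2x` on one half and `0` on the other, which halves the ratio bound. For `θ = 1` the mean
of `|y ± x|` is at least `x ≥ |y| + (1 - ρ) * x` wherever `|y| ≤ ρ * x`, hence the gain in `A`. -/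
theorem HaarBranch.succ (hp : p ≤ 2) (ht : p ≠ ⊤) (hT : ∀ k, IsCompactOperator (T k))
    (hsum : ∀ f, HasSum (fun k => T k f) f) {ρ A B : ℝ}
    (hB : ∀ ε > 0, HaarBranch p T ρ A B ε) {θ : ℝ} (hθ : θ = 0 ∨ θ = 1) {ε : ℝ} (hε : 0 < ε) :
    HaarBranch p T ((θ + ρ) / 2) (A + θ * (1 - ρ)) (2 ^ (p.toReal - 1) * B) ε := by
  have hp0 : 0 < p.toReal :=
    ENNReal.toReal_pos (zero_lt_one.trans_le (Fact.out : 1 ≤ p)).ne' ht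
  -- The case `θ = 1` has five error terms.
  have hδ : 0 < ε / 5 := by linarith
  obtain ⟨n, x, y, G, S, hGS, hx0, hx1, hxp, hxy, hy, hG, hS⟩ := hB (ε / 5) hδ
  have hlim : Tendsto (fun m => ∑ k ∈ S, ‖T k (rademacherLp p n x m)‖) atTop (𝓝 0) := by
    have := tendsto_finsetSum S fun k _ => (tendsto_compact_rademacherLp hp n x (hT k)).norm
    simpa using this
  obtain ⟨m, hm⟩ := (hlim.eventually (gt_mem_nhds hδ)).exists
  set d := rademacherLp p n x m with hd
  set x' : ℕ → ℝ := fun j => x (j / 2 ^ (m + 1)) + mulRademacher x m j with hx'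
  set y' : ℕ → ℝ := fun j => y (j / 2 ^ (m + 1)) + θ * mulRademacher x m j with hy'
  have hfx : stepLp p (n + m + 1) x' = stepLp p n x + d := by
    rw [← stepLp_comp_div p n (m + 1) x, hd, rademacherLp, ← add_assoc, ← map_add]
    rfl
  have hfy : stepLp p (n + m + 1) y' = stepLp p n y + θ • d := by
    rw [← stepLp_comp_div p n (m + 1) y, hd, rademacherLp, ← add_assoc, ← map_smul, ← map_add]
    rfl
  obtain ⟨s1, hs1⟩ := summable_iff_vanishing_norm.1
    (hsum (stepLp p (n + m + 1) x')).summable ε hε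
  have h2 := hsum d
  rw [HasSum, Metric.tendsto_nhds] at h2
  obtain ⟨s2, hs2⟩ := eventually_atTop.1 (h2 (ε / 5) hδ)
  -- `s1` controls the tails at the new density, `s2` makes the partial sum over `S'` reproduce `d`.
  set S' := S ∪ (s1 ∪ s2) with hS'
  have hSS' : S ⊆ S' := Finset.subset_union_left
  have hsub : ∀ H ⊆ S, ‖∑ k ∈ H, T k d‖ ≤ ε / 5 := fun H hH =>
    ((norm_sum_le _ _).trans
      (Finset.sum_le_sum_of_subset_of_nonneg hH fun _ _ _ => norm_nonneg _)).trans hm.le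
  have hS'd : ‖∑ k ∈ S', T k d - d‖ ≤ ε / 5 := by
    rw [← dist_eq_norm]
    exact (hs2 S' (Finset.subset_union_right.trans Finset.subset_union_right)).le
  have htail : ∀ t : Finset ℕ, Disjoint t S' →
      ‖∑ k ∈ t, T k (stepLp p (n + m + 1) x')‖ ≤ ε := fun t htS =>
    (hs1 t (htS.mono_right (Finset.subset_union_left.trans Finset.subset_union_right))).le
  obtain ⟨G', hG'S, hG'⟩ : ∃ G' ⊆ S',
      ‖∑ k ∈ G', T k (stepLp p (n + m + 1) x') - stepLp p (n + m + 1) y'‖ ≤ ε := by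
    rw [hfx, hfy]
    rcases hθ with rfl | rfl
    · refine ⟨G, hGS.trans hSS', ?_⟩
      have e : ∑ k ∈ G, T k (stepLp p n x + d) - (stepLp p n y + (0 : ℝ) • d) =
          (∑ k ∈ G, T k (stepLp p n x) - stepLp p n y) + ∑ k ∈ G, T k d := by
        simp only [map_add, Finset.sum_add_distrib, zero_smul]
        abel
      rw [e]
      exact (norm_add_le _ _).trans (by linarith [hsub G hGS])
    -- The new block `S' \ S` nearly kills the old density and nearly fixes `d`, so adding it
    -- selects exactly the new difference.
    · refine ⟨G ∪ (S' \ S), Finset.union_subset (hGS.trans hSS') Finset.sdiff_subset, ?_⟩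
      have hdis : Disjoint G (S' \ S) := Finset.disjoint_sdiff.mono_left hGS
      have e : ∑ k ∈ G ∪ (S' \ S), T k (stepLp p n x + d) - (stepLp p n y + (1 : ℝ) • d) =
          (∑ k ∈ G, T k (stepLp p n x) - stepLp p n y) + ∑ k ∈ G, T k d +
            ∑ k ∈ S' \ S, T k (stepLp p n x) + (∑ k ∈ S', T k d - d) - ∑ k ∈ S, T k d := by
        rw [Finset.sum_union hdis, ← Finset.sum_sdiff hSS']
        simp only [map_add, Finset.sum_add_distrib, one_smul]
        abel
      rw [e]
      have b1 := hsub G hGS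
      have b2 := hsub S subset_rfl
      have b3 := hS _ (Finset.sdiff_disjoint : Disjoint (S' \ S) S)
      refine (norm_sub_le _ _).trans ?_
      have c1 := norm_add_le ((∑ k ∈ G, T k (stepLp p n x) - stepLp p n y) + ∑ k ∈ G, T k d +
            ∑ k ∈ S' \ S, T k (stepLp p n x)) (∑ k ∈ S', T k d - d)
      have c2 := norm_add₃_le (a := ∑ k ∈ G, T k (stepLp p n x) - stepLp p n y)
        (b := ∑ k ∈ G, T k d) (c := ∑ k ∈ S' \ S, T k (stepLp p n x))
      linarith
  have hdiv : ∀ i, 2 * i / 2 ^ (m + 1) = i / 2 ^ m ∧ (2 * i + 1) / 2 ^ (m + 1) = i / 2 ^ m := by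
    intro i
    rw [pow_succ', ← Nat.div_div_eq_div_mul, ← Nat.div_div_eq_div_mul,
      show 2 * i / 2 = i by omega, show (2 * i + 1) / 2 = i by omega]
    exact ⟨rfl, rfl⟩
  have xe : ∀ i, x' (2 * i) = 2 * x (i / 2 ^ m) := fun i => by
    simp only [hx', mulRademacher_even, (hdiv i).1]; ring
  have xo : ∀ i, x' (2 * i + 1) = 0 := fun i => by
    simp only [hx', mulRademacher_odd, (hdiv i).2]; ring
  have ye : ∀ i, y' (2 * i) = y (i / 2 ^ m) + θ * x (i / 2 ^ m) := fun i => by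
    simp only [hy', mulRademacher_even, (hdiv i).1]
  have yo : ∀ i, y' (2 * i + 1) = y (i / 2 ^ m) - θ * x (i / 2 ^ m) := fun i => by
    simp only [hy', mulRademacher_odd, (hdiv i).2]; ring
  have hθ0 : 0 ≤ θ := by rcases hθ with rfl | rfl <;> norm_num
  refine ⟨n + m + 1, x', y', G', S', hG'S, fun j => ?_, ?_, ?_, fun j => ?_, ?_, hG', htail⟩
  · obtain ⟨i, rfl | rfl⟩ := Nat.even_or_odd' j
    · rw [xe]; linarith [hx0 (i / 2 ^ m)]
    · rw [xo]
  · rw [dyadicAvg_succ, ← hx1, ← dyadicAvg_comp_div n m]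
    congr 1
    ext i
    rw [xe, xo]; ring
  · rw [dyadicAvg_succ, ← hxp, ← dyadicAvg_comp_div n m, ← dyadicAvg_const_mul]
    congr 1
    ext i
    rw [xe, xo, abs_mul, Real.mul_rpow (abs_nonneg _) (abs_nonneg _), abs_zero,
      Real.zero_rpow hp0.ne', abs_two, Real.rpow_sub_one two_ne_zero]
    ring
  · obtain ⟨i, rfl | rfl⟩ := Nat.even_or_odd' j
    · rw [xe, ye]
      rcases hxy (i / 2 ^ m) with h | h
      · left; rw [h, mul_zero]
      · right
        refine (abs_add_le _ _).trans ?_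
        rw [abs_mul, abs_of_nonneg hθ0, abs_of_nonneg (hx0 _)]
        linarith
    · left; exact xo i
  · calc A + θ * (1 - ρ) ≤ dyadicAvg n (fun i => |y i|) + θ * (1 - ρ) * dyadicAvg n x := by
          rw [hx1]; linarith
      _ = dyadicAvg (n + m) (fun i => |y (i / 2 ^ m)| + θ * (1 - ρ) * x (i / 2 ^ m)) := by
          rw [← dyadicAvg_comp_div n m, ← dyadicAvg_comp_div n m x, ← dyadicAvg_const_mul,
            ← dyadicAvg_add]
      _ ≤ _ := by
          rw [dyadicAvg_succ]
          refine dyadicAvg_mono fun i => ?_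
          rw [ye, yo]
          rcases hθ with rfl | rfl
          · simp
          · rcases hxy (i / 2 ^ m) with h | h
            · simp [h]
            · have a1 := le_abs_self (y (i / 2 ^ m) + 1 * x (i / 2 ^ m))
              have a2 := neg_abs_le (y (i / 2 ^ m) - 1 * x (i / 2 ^ m))
              linarith

/-- A step with `θ = 1` gains `1 / 2` in `A` and raises the ratio bound to `3 / 4`; a step with `θ =
0` brings it down to `3 / 8 ≤ 1 / 2`, so the pair can be repeated. -/
theorem haarBranch_iterate (hp : p ≤ 2) (ht : p ≠ ⊤) (hT : ∀ k, IsCompactOperator (T k))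
    (hsum : ∀ f, HasSum (fun k => T k f) f) (s : ℕ) :
    ∀ ε > 0, HaarBranch p T (1 / 2) (s / 2) ((2 ^ (p.toReal - 1)) ^ (2 * s)) ε := by
  induction s with
  | zero => simpa using fun ε hε => haarBranch_zero hsum hε
  | succ s ih =>
    intro ε hε
    have h1 := fun ε (hε : ε > 0) => HaarBranch.succ hp ht hT hsum ih (θ := 1) (Or.inr rfl) hε
    obtain ⟨n, x, y, G, S, hGS, hx0, hx1, hxp, hxy, hy, hG, hS⟩ :=
      HaarBranch.succ hp ht hT hsum h1 (θ := 0) (Or.inl rfl) hε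
    refine ⟨n, x, y, G, S, hGS, hx0, hx1, ?_, fun i => (hxy i).imp_right fun h => ?_, ?_, hG, hS⟩
    · rw [hxp]; ring
    · nlinarith [hx0 i]
    · push_cast; linarith

theorem le_of_compact_expansion (hp1 : 1 < p) (hp : p ≤ 2) (hT : ∀ k, IsCompactOperator (T k))
    (hsum : ∀ f, HasSum (fun k => T k f) f) {C : ℝ} (hC0 : 0 ≤ C)
    (hC : ∀ (F : Finset ℕ) f, ‖∑ k ∈ F, T k f‖ ≤ C * ‖f‖) (s : ℕ) :
    (s : ℝ) / 2 ≤ C * (2 ^ (p.toReal - 1)) ^ (2 * s) + 1 := by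
  have ht : p ≠ ⊤ := (hp.trans_lt ENNReal.ofNat_lt_top).ne
  have hpr : 1 < p.toReal := by
    rw [← ENNReal.toReal_one]
    exact (ENNReal.toReal_lt_toReal ENNReal.one_ne_top ht).2 hp1
  obtain ⟨n, x, y, G, S, -, -, -, hxp, -, hy, hG, -⟩ :=
    haarBranch_iterate hp ht hT hsum s 1 one_pos
  -- A norm that is at least `1` is bounded by its own `p`-th power, so no root is needed.
  have h1 : ‖stepLp p n x‖ ≤ (2 ^ (p.toReal - 1)) ^ (2 * s) := by
    have hB1 : (1:ℝ) ≤ (2 ^ (p.toReal - 1)) ^ (2 * s) :=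
      one_le_pow₀ (Real.one_le_rpow one_le_two (by linarith))
    rcases le_total ‖stepLp p n x‖ 1 with h | h
    · exact h.trans hB1
    · rw [← hxp, dyadicAvg, ← norm_stepLp_rpow (zero_lt_one.trans hp1).ne' ht]
      exact Real.self_le_rpow_of_one_le h hpr.le
  have h2 : (s : ℝ) / 2 ≤ ‖stepLp p n y‖ := by
    refine hy.trans ?_
    rw [dyadicAvg, ← norm_stepLp_one]
    exact norm_stepLp_mono hp1.le n y
  have h3 := hC G (stepLp p n x)
  have h4 : ‖stepLp p n y‖ ≤ ‖∑ k ∈ G, T k (stepLp p n x)‖ + 1 := by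
    have := norm_sub_norm_le (stepLp p n y) (∑ k ∈ G, T k (stepLp p n x))
    rw [norm_sub_rev] at this
    linarith
  have h5 := mul_le_mul_of_nonneg_left h1 hC0
  linarith

end Branch

/-! ### Uniform boundedness, compression to one coordinate, and the conclusion. -/

theorem exists_norm_sum_le_of_hasSum {E F : Type*} [NormedAddCommGroup E] [NormedSpace ℝ E]
    [CompleteSpace E] [NormedAddCommGroup F] [NormedSpace ℝ F] [CompleteSpace F] (T : ℕ → E →L[ℝ] F)
    (hT : ∀ x, Summable fun k => T k x) :
    ∃ C : ℝ, 0 ≤ C ∧ ∀ (s : Finset ℕ) (x : E), ‖∑ k ∈ s, T k x‖ ≤ C * ‖x‖ := by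
  obtain ⟨C, hC⟩ := banach_steinhaus (g := fun s : Finset ℕ => ∑ k ∈ s, T k) fun x => by
    obtain ⟨s, hs⟩ := summable_iff_vanishing_norm.1 (hT x) 1 one_pos
    refine ⟨∑ k ∈ s, ‖T k x‖ + 1, fun t => ?_⟩
    rw [sum_apply, ← Finset.sum_inter_add_sum_sdiff t s]
    refine (norm_add_le _ _).trans (add_le_add ?_ (hs _ Finset.sdiff_disjoint).le)
    exact (norm_sum_le _ _).trans (Finset.sum_le_sum_of_subset_of_nonneg Finset.inter_subset_right
      fun _ _ _ => norm_nonneg _)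
  refine ⟨C, (norm_nonneg _).trans (hC ∅), fun s x => ?_⟩
  rw [← sum_apply]
  exact ContinuousLinearMap.le_of_opNorm_le _ (hC s) x

theorem id_notMem_unc_compactOps (p : ℕ → ℝ≥0∞) [∀ n, Fact (1 ≤ p n)]
    (hp_gt : ∀ n, 1 < p n) (hp_lim : Tendsto p atTop (𝓝 1)) :
    ContinuousLinearMap.id ℝ (L2SumLp p) ∉ unc (compactOps (L2SumLp p) (L2SumLp p)) := by
  rintro ⟨T, hT, hsum⟩
  obtain ⟨C, hC0, hC⟩ := exists_norm_sum_le_of_hasSum T fun x => (hsum x).summable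
  -- `s` is fixed before `n`; then `n` is chosen so that the power of `2` falls below `2`, which
  -- contradicts this choice.
  obtain ⟨s, hs⟩ := exists_nat_gt (2 * (C * 2 + 1))
  have hlim : Tendsto (fun n => ((2 : ℝ) ^ ((p n).toReal - 1)) ^ (2 * s)) atTop (𝓝 1) := by
    have h1 : Tendsto (fun n => (p n).toReal) atTop (𝓝 1) :=
      (ENNReal.tendsto_toReal ENNReal.one_ne_top).comp hp_lim
    have h2 := ((tendsto_const_nhds (x := (2 : ℝ))).rpow (h1.sub_const 1)
      (Or.inl two_ne_zero)).pow (2 * s)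
    simpa using h2
  obtain ⟨n, hn1, hn2⟩ := ((hp_lim.eventually (gt_mem_nhds (ENNReal.one_lt_two))).and
    (hlim.eventually (gt_mem_nhds (one_lt_two)))).exists
  let J := lp.singleContinuousLinearMap ℝ (fun n => LpUnit (p n)) 2 n
  let P := lp.evalCLM ℝ (fun n => LpUnit (p n)) 2 n
  have hPJ : ∀ f, P (J f) = f := fun f =>
    lp.single_apply_self (E := fun n => LpUnit (p n)) 2 n f
  have hJ : ∀ f, ‖J f‖ = ‖f‖ := fun f =>
    lp.norm_single (E := fun n => LpUnit (p n)) (p := 2) (by norm_num) n f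
  have hP : ∀ g, ‖P g‖ ≤ ‖g‖ := fun g => lp.norm_apply_le_norm two_ne_zero g n
  have key := le_of_compact_expansion (p := p n) (T := fun k => P.comp ((T k).comp J)) (hp_gt n)
    hn1.le (fun k => ((hT k).comp_clm J).clm_comp P) (fun f => by
      have := (hsum (J f)).mapL P
      simpa [hPJ] using this) hC0 (fun F f => by
      have h1 : ∑ k ∈ F, P.comp ((T k).comp J) f = P (∑ k ∈ F, T k (J f)) := by
        rw [map_sum]; rfl
      rw [h1, ← hJ f]
      exact (hP _).trans (hC F (J f))) s
  have := mul_le_mul_of_nonneg_left hn2.le hC0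
  linarith

theorem theorem3p3 (p : ℕ → ℝ≥0∞) [∀ n, Fact (1 ≤ p n)]
    (hp_gt : ∀ n, 1 < p n) (hp_lt : ∀ n, p n < ⊤) (hp_lim : Tendsto p atTop (𝓝 1)) :
    CompleteSpace (L2SumLp p) ∧
      ContinuousLinearMap.id ℝ (L2SumLp p) ∈
        unc (unc (compactOps (L2SumLp p) (L2SumLp p))) ∧
      ContinuousLinearMap.id ℝ (L2SumLp p) ∉
        unc (compactOps (L2SumLp p) (L2SumLp p)) :=
  ⟨inferInstance, id_mem_unc_unc_compactOps p hp_gt hp_lt, id_notMem_unc_compactOps p hp_gt hp_lim⟩
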